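/- Let $V$ be a valuation domain of rank one with quotient field $K$, let $v:K\to\mathbb{R}\cup\{\infty\}$ be the associated valuation, and let $X$ be an indeterminate. A sequence $E=\{s_n\}_{n\in\mathbb{N}}$ in $K$ is *pseudo-convergent* if $v(s_{n+1}-s_n)<v(s_{n+2}-s_{n+1})$ for all $n$; its *breadth* is $\lim_n v(s_{n+1}-s_n)\in\mathbb{R}\cup\{\infty\}$; an element $\alpha\in K$ is a *pseudo-limit* of $E$ if $v(\alpha-s_n)<v(\alpha-s_{n+1})$ for all $n$; and $E$ is of *algebraic type* if $v(f(s_n))$ is eventually strictly increasing for some $f\in K[X]$. Put $$V_E=\{\phi\in K(X)\mid \phi(s_n)\in V\text{ for all but finitely many }n\},\qquad w_E(\phi)=\lim_{n\to\infty}v(\phi(s_n))\quad(\phi\in K(X)),$$ and, when $w_E$ is a valuation $K(X)\to\mathbb{R}\cup\{\infty\}$, let $W_E=\{\phi\in K(X)\mid w_E(\phi)\ge 0\}$ be its valuation domain. Let $\mathrm{Zar}(K(X)|V)^{\mathrm{cons}}$ be the set of valuation domains of $K(X)$ containing $V$, endowed with the constructible topology, i.e. the coarsest topology for which all sets $\{W\mid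 \phi_1,\dots,\phi_k\in W\}$ (with $\phi_1,\dots,\phi_k\in K(X)$) are both open and closed. **Proposition 6.6.** Let $E=\{s_n\}_{n\in\mathbb{N}}\subset K$ be a pseudo-convergent sequence of algebraic type with breadth $\delta$. For each $n\in\mathbb{N}$ let $\zeta_n\in[\delta,\infty]$ and let $E_n\subset K$ be a pseudo-convergent sequence with pseudo-limit $s_n$ and breadth $\zeta_n$. Then: (a) $V_E$ and all the $V_{E_n}$ are valuation domains of $K(X)$ containing $V$, and $V_E$ is a limit of the sequence $\{V_{E_n}\}_{n\in\mathbb{N}}$ in $\mathrm{Zar}(K(X)|V)^{\mathrm{cons}}$; (b) if $\zeta_n\neq\infty$ for every $n$, then every $w_{E_n}$ is a valuation on $K(X)$, every $W_{E_n}$ contains $V$, and $V_E$ is a limit of the sequence $\{W_{E_n}\}_{n\in\mathbb{N}}$ in $\mathrm{Zar}(K(X)|V)^{\mathrm{cons}}$. -/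

import Mathlib

open Filter Topology

noncomputable section

/-! ### The Zariski space with the constructible topology -/

/-- The Zariski space `Zar(L|D)`: the set of valuation domains of the field `L` (with quotient
field `L`) that contain `D`. -/
def ZarSpace (D L : Type*) [CommRing D] [Field L] [Algebra D L] : Type _ :=
  {W : ValuationSubring L // ∀ d : D, algebraMap D L d ∈ W}

namespace ZarSpace

variable {D L : Type*} [CommRing D] [Field L] [Algebra D L]

/-- The valuation domain underlying a point of `Zar(L|D)`. -/
def ring (W : ZarSpace D L) : ValuationSubring L := W.1

/-- `B(φ₁, …, φₖ)`: the valuation domains in `Zar(L|D)` containing `φ₁, …, φₖ`. -/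
def basicOpen (D : Type*) {L : Type*} [CommRing D] [Field L] [Algebra D L] (F : Finset L) :
    Set (ZarSpace D L) :=
  {W | ∀ φ ∈ F, φ ∈ W.ring}

/-- The constructible topology on `Zar(L|D)`: the coarsest topology for which every
`B(φ₁, …, φₖ)` is both open and closed. -/
instance constructibleTopology : TopologicalSpace (ZarSpace D L) :=
  TopologicalSpace.generateFrom
    {U | ∃ F : Finset L, U = basicOpen D F ∨ U = (basicOpen D F)ᶜ}

end ZarSpace

/-! ### Pseudo-convergent sequences -/

section PseudoConvergent

variable {K : Type*} [Field K]

/-- The valuation domain `{x | 0 ≤ v x}` of a valuation `v : K → ℝ ∪ {∞}`, or of a valuation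
`K(X) → ℝ ∪ {∞}` (membership unfolds to `0 ≤ v x`, since `AddValuation.toValuation` reverses
the order of the values). -/
def valRing (v : AddValuation K (WithTop ℝ)) : ValuationSubring K :=
  (AddValuation.toValuation v).valuationSubring

theorem mem_valRing (v : AddValuation K (WithTop ℝ)) (x : K) : x ∈ valRing v ↔ 0 ≤ v x :=
  Iff.rfl

/-- `v` has rank one: real-valued valuations have rank at most one, so this is nontriviality. -/
def IsRankOne (v : AddValuation K (WithTop ℝ)) : Prop :=
  ∃ x : K, x ≠ 0 ∧ v x ≠ 0

/-- The gauge `δₙ = v(sₙ₊₁ - sₙ)`. -/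
def gaugeSeq (v : AddValuation K (WithTop ℝ)) (s : ℕ → K) (n : ℕ) : WithTop ℝ :=
  v (s (n + 1) - s n)

def IsPseudoConvergent (v : AddValuation K (WithTop ℝ)) (s : ℕ → K) : Prop :=
  ∀ n, v (s (n + 1) - s n) < v (s (n + 2) - s (n + 1))

def IsPseudoLimit (v : AddValuation K (WithTop ℝ)) (s : ℕ → K) (α : K) : Prop :=
  ∀ n, v (α - s n) < v (α - s (n + 1))

/-- `δ ∈ ℝ ∪ {∞}` is the breadth, the limit of the gauge (in the order topology). -/
def HasBreadth (v : AddValuation K (WithTop ℝ)) (s : ℕ → K) (δ : WithTop ℝ) : Prop :=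
  Tendsto (gaugeSeq v s) atTop (𝓝 δ)

/-- Algebraic type: for some polynomial `f`, the sequence `v(f(sₙ))` is eventually strictly
increasing. -/
def IsAlgebraicType (v : AddValuation K (WithTop ℝ)) (s : ℕ → K) : Prop :=
  ∃ f : Polynomial K, ∃ N : ℕ, ∀ n, N ≤ n → v (f.eval (s n)) < v (f.eval (s (n + 1)))

/-- The value `φ(t)` of a rational function. (Where the reduced denominator of `φ` vanishes the
value is `0` by convention; the terms of a pseudo-convergent sequence are distinct, so this
affects only finitely many of them.) -/
def ratEval (φ : RatFunc K) (t : K) : K :=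
  φ.eval (RingHom.id K) t

/-- `V_E = {φ ∈ K(X) | φ(sₙ) ∈ V for all but finitely many n}`. -/
def ringVE (v : AddValuation K (WithTop ℝ)) (s : ℕ → K) : Set (RatFunc K) :=
  {φ | {n : ℕ | ratEval φ (s n) ∉ valRing v}.Finite}

/-- `w` is the Ostrowski valuation `w_E` of `E = (sₙ)`: a valuation `K(X) → ℝ ∪ {∞}` with
`w(φ) = lim v(φ(sₙ))` for every `φ`. It is unique if it exists, and its valuation domain
`valRing w` is then `W_E`. -/
def IsOstrowskiValuation (v : AddValuation K (WithTop ℝ)) (s : ℕ → K)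
    (w : AddValuation (RatFunc K) (WithTop ℝ)) : Prop :=
  ∀ φ : RatFunc K, Tendsto (fun n => v (ratEval φ (s n))) atTop (𝓝 (w φ))

end PseudoConvergent

end

noncomputable section

/-! ### Extending a real valuation to an overfield -/

/-! Extend `v` to the algebraic closure and split polynomials into linear factors. Along `s`, the
value of `X - a` is either eventually constant or equal to the gauge. Hence for `φ ≠ 0` and large
`n`, `v(φ(sₙ)) = c + m gₙ`, where `gₙ` is the gauge, and every `t` with `v(t - sₙ) > gₙ` gives the
same value (`exists_ratEval_eq`). An affine function of an increasing gauge has eventually constant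
sign, so `V_E` is a valuation ring. Since `gₙ < δ ≤ ζₙ`, the terms of `Eₙ` eventually enter the ball
where `v ∘ φ` equals `v(φ(sₙ))` (`eventually_ratEval_eq`). Membership of `φ` in `V_{Eₙ}`, `W_{Eₙ}`
and `V_E` is then the sign of this value for large `n`. -/

theorem exists_valuationSubring_valuation_le_iff {K : Type*} [Field K]
    (v : AddValuation K (WithTop ℝ)) (L : Type*) [Field L] [Algebra K L] :
    ∃ A : ValuationSubring L, ∀ x y : K,
      A.valuation (algebraMap K L x) ≤ A.valuation (algebraMap K L y) ↔ v y ≤ v x := by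
  obtain ⟨A, h, hA⟩ := IsLocalRing.exists_factor_valuationRing
    ((algebraMap K L).comp (valRing v).subtype)
  have hmem : ∀ x : K, algebraMap K L x ∈ A ↔ 0 ≤ v x := by
    refine fun x => ⟨fun hx => ?_, fun hx => h ⟨x, hx⟩⟩
    by_contra hneg
    have hneg' : x ∉ valRing v := hneg
    have hx0 : x ≠ 0 := by
      rintro rfl
      exact hneg' (zero_mem _)
    have hinv : x⁻¹ ∈ valRing v := ((valRing v).mem_or_inv_mem x).resolve_left hneg'
    -- `A` dominates `V`: `x⁻¹` is a unit of `A` lying in `V`, hence a unit of `V`, which forces `x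
    -- ∈ V`.
    have hunit : IsUnit ((((algebraMap K L).comp (valRing v).subtype).codRestrict A.toSubring h)
        ⟨x⁻¹, hinv⟩) := by
      refine IsUnit.of_mul_eq_one ⟨algebraMap K L x, hx⟩ (Subtype.ext ?_)
      change algebraMap K L x⁻¹ * algebraMap K L x = 1
      rw [← map_mul, inv_mul_cancel₀ hx0, map_one]
    obtain ⟨u, hu⟩ := hA.map_nonunit _ hunit
    have h1 : ((u⁻¹ : (valRing v)ˣ) : valRing v) * ⟨x⁻¹, hinv⟩ = 1 := by
      rw [← hu, Units.inv_mul]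
    have h2 : (((u⁻¹ : (valRing v)ˣ) : valRing v) : K) * x⁻¹ = 1 := congrArg Subtype.val h1
    have h3 : (((u⁻¹ : (valRing v)ˣ) : valRing v) : K) = x := by
      field_simp at h2
      exact h2
    exact hneg' (h3 ▸ (((u⁻¹ : (valRing v)ˣ) : valRing v)).2)
  refine ⟨A, fun x y => ?_⟩
  rcases eq_or_ne y 0 with rfl | hy
  · rw [map_zero, map_zero, le_zero_iff, Valuation.zero_iff, map_eq_zero, AddValuation.map_zero,
      top_le_iff, AddValuation.top_iff]
  · have hy' : A.valuation (algebraMap K L y) ≠ 0 := by simpa using hy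
    have hvy : v y ≠ ⊤ := by simpa [AddValuation.top_iff] using hy
    have hxy : v x = v (x / y) + v y := by rw [← AddValuation.map_mul, div_mul_cancel₀ x hy]
    rw [← div_le_one₀ (zero_lt_iff.mpr hy'), ← map_div₀, ← map_div₀, A.valuation_le_one_iff, hmem,
      hxy]
    generalize v (x / y) = a at *
    lift v y to ℝ using hvy with b
    induction a with
    | top => simp
    | coe a =>
      norm_cast
      constructor <;> intro h <;> linarith

/-! ### Polynomials along a pseudo-convergent sequence -/

section Overfield

variable {L Γ : Type*} [Field L] [LinearOrderedCommGroupWithZero Γ] (u : Valuation L Γ) (s : ℕ → L)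

/-- Along a sequence `s` the polynomial `f` has value a monomial in the gauge, and this value is
shared by all points sufficiently close to `s n`. -/
def IsGaugeMonomial (f : Polynomial L) : Prop :=
  ∃ (N m : ℕ) (c : Γ), ∀ n, N ≤ n → u (f.eval (s n)) = c * u (s (n + 1) - s n) ^ m ∧
    ∀ t, u (t - s n) < u (s (n + 1) - s n) → u (f.eval t) = u (f.eval (s n))

variable {u s}

theorem IsGaugeMonomial.const (a : L) : IsGaugeMonomial u s (Polynomial.C a) :=
  ⟨0, 0, u a, by simp⟩

theorem IsGaugeMonomial.mul {f g : Polynomial L} (hf : IsGaugeMonomial u s f)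
    (hg : IsGaugeMonomial u s g) : IsGaugeMonomial u s (f * g) := by
  obtain ⟨N, m, c, h⟩ := hf
  obtain ⟨N', m', c', h'⟩ := hg
  refine ⟨max N N', m + m', c * c', fun n hn => ?_⟩
  obtain ⟨h1, h2⟩ := h n (le_trans (le_max_left _ _) hn)
  obtain ⟨h1', h2'⟩ := h' n (le_trans (le_max_right _ _) hn)
  refine ⟨?_, fun t ht => ?_⟩
  · rw [Polynomial.eval_mul, map_mul, h1, h1', pow_add, mul_mul_mul_comm]
  · rw [Polynomial.eval_mul, Polynomial.eval_mul, map_mul, map_mul, h2 t ht, h2' t ht]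

theorem valuation_sub_eq_gauge (hs : ∀ n, u (s (n + 2) - s (n + 1)) < u (s (n + 1) - s n))
    {n k : ℕ} (hnk : n < k) : u (s k - s n) = u (s (n + 1) - s n) := by
  have hanti : StrictAnti fun n => u (s (n + 1) - s n) := strictAnti_nat_of_succ_lt hs
  induction k, hnk using Nat.le_induction with
  | base => rfl
  | succ k hk ih =>
    have hlt : u (s (k + 1) - s k) < u (s k - s n) := by
      rw [ih]
      exact hanti hk
    rw [← ih, ← u.map_add_eq_of_lt_left hlt, sub_add_sub_cancel']

/-- If `a` is ever farther from `s N` than the gauge at `N`, the distance to `a` is frozen from then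
on. Otherwise the distance equals the gauge at every `n`: were it smaller, the next distance would
be the gauge at `n`, which exceeds the gauge at `n + 1`. -/
theorem IsGaugeMonomial.X_sub_C (hs : ∀ n, u (s (n + 2) - s (n + 1)) < u (s (n + 1) - s n))
    (a : L) : IsGaugeMonomial u s (Polynomial.X - Polynomial.C a) := by
  have hanti : StrictAnti fun n => u (s (n + 1) - s n) := strictAnti_nat_of_succ_lt hs
  by_cases hN : ∃ N, u (s (N + 1) - s N) < u (s N - a)
  · obtain ⟨N, hN⟩ := hN
    have key : ∀ n, N ≤ n → u (s n - a) = u (s N - a) := by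
      intro n hn
      rcases hn.eq_or_lt with rfl | hn
      · rfl
      · have hlt : u (s n - s N) < u (s N - a) := by rwa [valuation_sub_eq_gauge hs hn]
        rw [← u.map_add_eq_of_lt_left hlt, sub_add_sub_cancel']
    refine ⟨N, 0, u (s N - a), fun n hn => ⟨by simpa using key n hn, fun t ht => ?_⟩⟩
    have hlt : u (t - s n) < u (s n - a) := by
      rw [key n hn]
      exact ht.trans_le ((hanti.antitone hn).trans hN.le)
    simpa using u.map_add_eq_of_lt_left hlt
  · push Not at hN
    have key : ∀ n, u (s n - a) = u (s (n + 1) - s n) := by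
      refine fun n => (hN n).antisymm (le_of_not_gt fun hlt => ?_)
      have h1 := u.map_add_eq_of_lt_left hlt
      rw [sub_add_sub_cancel] at h1
      exact absurd (hN (n + 1)) (by
        rw [h1, not_le]
        exact hs n)
    refine ⟨0, 1, 1, fun n _ => ⟨by simpa using key n, fun t ht => ?_⟩⟩
    rw [← key n] at ht
    simpa using u.map_add_eq_of_lt_left ht

theorem IsGaugeMonomial.of_splits
    (hs : ∀ n, u (s (n + 2) - s (n + 1)) < u (s (n + 1) - s n)) {f : Polynomial L}
    (hf : f.Splits) : IsGaugeMonomial u s f := by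
  rw [hf.eq_prod_roots]
  refine (IsGaugeMonomial.const _).mul ?_
  induction f.roots using Multiset.induction_on with
  | empty => simpa using IsGaugeMonomial.const (u := u) (s := s) 1
  | cons a r ih =>
    rw [Multiset.map_cons, Multiset.prod_cons]
    exact (IsGaugeMonomial.X_sub_C hs a).mul ih

end Overfield

section Real

variable {K : Type*} [Field K] {v : AddValuation K (WithTop ℝ)} {s : ℕ → K}

theorem IsPseudoConvergent.exists_real_gauge (hs : IsPseudoConvergent v s) :
    ∃ g : ℕ → ℝ, StrictMono g ∧ ∀ n, v (s (n + 1) - s n) = g n := by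
  choose g hg using fun n => WithTop.ne_top_iff_exists.mp ((hs n).trans_le le_top).ne
  refine ⟨g, strictMono_nat_of_lt_succ fun n => ?_, fun n => (hg n).symm⟩
  have := hs n
  rw [← hg n, ← hg (n + 1)] at this
  exact_mod_cast this

theorem IsPseudoConvergent.exists_eval_eq (hs : IsPseudoConvergent v s) {g : ℕ → ℝ}
    (hg : ∀ n, v (s (n + 1) - s n) = g n) {f : Polynomial K} (hf : f ≠ 0) :
    ∃ (N : ℕ) (c m : ℝ), ∀ n, N ≤ n → v (f.eval (s n)) = ((c + m * g n : ℝ) : WithTop ℝ) ∧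
      ∀ t, (g n : WithTop ℝ) < v (t - s n) → v (f.eval t) = v (f.eval (s n)) := by
  obtain ⟨A, hA⟩ := exists_valuationSubring_valuation_le_iff v (AlgebraicClosure K)
  let ι := algebraMap K (AlgebraicClosure K)
  have hlt : ∀ x y : K, A.valuation (ι x) < A.valuation (ι y) ↔ v y < v x := fun x y => by
    rw [← not_le, hA, not_le]
  have heq : ∀ x y : K, A.valuation (ι x) = A.valuation (ι y) ↔ v x = v y := fun x y => by
    rw [le_antisymm_iff, hA, hA, and_comm, ← le_antisymm_iff]
  have hev : ∀ t, (f.map ι).eval (ι t) = ι (f.eval t) := fun t => by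
    rw [Polynomial.eval_map, Polynomial.eval₂_at_apply]
  obtain ⟨N₀, m, c, h⟩ := IsGaugeMonomial.of_splits (u := A.valuation) (s := fun n => ι (s n))
    (fun n => by simpa only [← map_sub] using (hlt _ _).mpr (hs n))
    (IsAlgClosed.splits (f.map ι))
  -- Real values require `f(sₙ) ≠ 0`; the terms of `s` are distinct, so only finitely many are
  -- roots.
  obtain ⟨M, hM⟩ : ∃ M, ∀ n, M ≤ n → f.eval (s n) ≠ 0 := by
    have hinj : Function.Injective s := by
      intro i j hij
      by_contra hne
      wlog hlt' : i < j generalizing i j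
      · exact this hij.symm (Ne.symm hne) (lt_of_le_of_ne (not_lt.mp hlt') (Ne.symm hne))
      have hsub := valuation_sub_eq_gauge (u := A.valuation) (s := fun n => ι (s n))
        (fun n => by simpa only [← map_sub] using (hlt _ _).mpr (hs n)) hlt'
      rw [← map_sub, ← map_sub, heq, hg, hij, sub_self, AddValuation.map_zero] at hsub
      exact WithTop.top_ne_coe hsub
    have hfin : {n | f.eval (s n) = 0}.Finite :=
      (Polynomial.finite_setOfPred_isRoot hf).preimage hinj.injOn
    have := hfin.eventually_cofinite_notMem
    rw [Nat.cofinite_eq_atTop] at this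
    exact eventually_atTop.mp this
  set N := max N₀ M
  have hN₀ : ∀ n, N ≤ n → N₀ ≤ n := fun n hn => (le_max_left _ _).trans hn
  have hNM : ∀ n, N ≤ n → M ≤ n := fun n hn => (le_max_right _ _).trans hn
  obtain ⟨e, he⟩ := WithTop.ne_top_iff_exists.mp
    (mt (AddValuation.top_iff v).mp (hM N (hNM N le_rfl)))
  -- The affine function is normalised by its value `e` at `N`.
  refine ⟨N, e - m * g N, m, fun n hn => ⟨?_, fun t ht => ?_⟩⟩
  · have h1 := (h n (hN₀ n hn)).1
    have h2 := (h N (hN₀ N le_rfl)).1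
    rw [hev, ← map_sub] at h1 h2
    -- The constant `c` need not be the value of an element of `K`; cross-multiplying the formulas
    -- at `n` and `N` eliminates it.
    have h3 : v (f.eval (s n) * (s (N + 1) - s N) ^ m) =
        v (f.eval (s N) * (s (n + 1) - s n) ^ m) := by
      rw [← heq]
      simp only [map_mul, map_pow]
      rw [h1, h2, mul_right_comm]
    rw [AddValuation.map_mul, AddValuation.map_mul, AddValuation.map_pow, AddValuation.map_pow,
      hg, hg, ← he] at h3
    obtain ⟨e', he'⟩ := WithTop.ne_top_iff_exists.mp
      (mt (AddValuation.top_iff v).mp (hM n (hNM n hn)))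
    rw [← he', ← WithTop.coe_nsmul, ← WithTop.coe_nsmul, ← WithTop.coe_add, ← WithTop.coe_add,
      WithTop.coe_eq_coe, nsmul_eq_mul, nsmul_eq_mul] at h3
    rw [← he', WithTop.coe_eq_coe]
    linarith
  · have := (h n (hN₀ n hn)).2 (ι t) (by
      rw [← map_sub, ← map_sub, hlt, hg]
      exact ht)
    rwa [hev, hev, heq] at this

/-! ### Rational functions along a pseudo-convergent sequence -/

theorem IsPseudoConvergent.exists_ratEval_eq (hs : IsPseudoConvergent v s) {g : ℕ → ℝ}
    (hg : ∀ n, v (s (n + 1) - s n) = g n) {φ : RatFunc K} (hφ : φ ≠ 0) :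
    ∃ (N : ℕ) (c m : ℝ), ∀ n, N ≤ n → v (ratEval φ (s n)) = ((c + m * g n : ℝ) : WithTop ℝ) ∧
      ∀ t, (g n : WithTop ℝ) < v (t - s n) → v (ratEval φ t) = v (ratEval φ (s n)) := by
  obtain ⟨N, c, m, h⟩ := hs.exists_eval_eq hg (RatFunc.num_ne_zero hφ)
  obtain ⟨N', c', m', h'⟩ := hs.exists_eval_eq hg (RatFunc.denom_ne_zero φ)
  have key : ∀ (t : K) (a b : ℝ), v (φ.num.eval t) = a → v (φ.denom.eval t) = b →
      v (ratEval φ t) = ((a - b : ℝ) : WithTop ℝ) := by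
    intro t a b ha hb
    -- A finite value excludes a zero denominator, hence the default value of the division.
    have hne : φ.denom.eval t ≠ 0 := fun h0 => by
      rw [h0, AddValuation.map_zero] at hb
      exact WithTop.coe_ne_top hb.symm
    have hmul : v (ratEval φ t) + v (φ.denom.eval t) = v (φ.num.eval t) := by
      rw [← AddValuation.map_mul]
      congr 1
      exact div_mul_cancel₀ _ hne
    rw [ha, hb] at hmul
    generalize v (ratEval φ t) = x at *
    induction x with
    | top => simp at hmul
    | coe x =>
      norm_cast at *
      linarith
  refine ⟨max N N', c - c', m - m', fun n hn => ?_⟩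
  obtain ⟨h1, h2⟩ := h n (le_trans (le_max_left _ _) hn)
  obtain ⟨h1', h2'⟩ := h' n (le_trans (le_max_right _ _) hn)
  refine ⟨?_, fun t ht => ?_⟩
  · rw [key _ _ _ h1 h1', WithTop.coe_eq_coe]
    ring
  · rw [key _ _ _ h1 h1', key t _ _ ((h2 t ht).trans h1) ((h2' t ht).trans h1')]

theorem IsPseudoConvergent.eventually_denom_ne_zero (hs : IsPseudoConvergent v s)
    (φ : RatFunc K) :
    ∀ᶠ n in atTop, Polynomial.eval₂ (RingHom.id K) (s n) φ.denom ≠ 0 := by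
  obtain ⟨g, -, hg⟩ := hs.exists_real_gauge
  obtain ⟨N, c, m, h⟩ := hs.exists_eval_eq hg (RatFunc.denom_ne_zero φ)
  filter_upwards [eventually_ge_atTop N] with n hn h0
  have h1 := (h n hn).1
  rw [← Polynomial.eval₂_id, h0, AddValuation.map_zero] at h1
  exact WithTop.coe_ne_top h1.symm

theorem IsPseudoConvergent.eventually_ratEval_add (hs : IsPseudoConvergent v s)
    (φ ψ : RatFunc K) :
    ∀ᶠ n in atTop, ratEval (φ + ψ) (s n) = ratEval φ (s n) + ratEval ψ (s n) := by
  filter_upwards [hs.eventually_denom_ne_zero φ, hs.eventually_denom_ne_zero ψ] with n h h'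
  exact RatFunc.eval_add _ _ h h'

theorem IsPseudoConvergent.eventually_ratEval_mul (hs : IsPseudoConvergent v s)
    (φ ψ : RatFunc K) :
    ∀ᶠ n in atTop, ratEval (φ * ψ) (s n) = ratEval φ (s n) * ratEval ψ (s n) := by
  filter_upwards [hs.eventually_denom_ne_zero φ, hs.eventually_denom_ne_zero ψ] with n h h'
  exact RatFunc.eval_mul _ _ h h'

@[simp]
theorem ratEval_C (a t : K) : ratEval (RatFunc.C a) t = a := by
  simp [ratEval]

theorem mem_ringVE_iff {φ : RatFunc K} :
    φ ∈ ringVE v s ↔ ∀ᶠ n in atTop, 0 ≤ v (ratEval φ (s n)) := by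
  rw [← Nat.cofinite_eq_atTop]
  rfl

/-- An affine function of a strictly increasing real sequence has eventually constant sign. -/
theorem StrictMono.eventually_affine_nonneg_or_neg {g : ℕ → ℝ} (hg : StrictMono g) (c m : ℝ) :
    (∀ᶠ n in atTop, 0 ≤ c + m * g n) ∨ ∀ᶠ n in atTop, c + m * g n < 0 := by
  rcases le_total 0 m with hm | hm
  · by_cases h : ∃ N, 0 ≤ c + m * g N
    · obtain ⟨N, hN⟩ := h
      left
      filter_upwards [eventually_ge_atTop N] with n hn
      have := mul_le_mul_of_nonneg_left (hg.monotone hn) hm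
      linarith
    · push Not at h
      exact Or.inr (Eventually.of_forall h)
  · by_cases h : ∃ N, c + m * g N < 0
    · obtain ⟨N, hN⟩ := h
      right
      filter_upwards [eventually_ge_atTop N] with n hn
      have := mul_le_mul_of_nonpos_left (hg.monotone hn) hm
      linarith
    · push Not at h
      exact Or.inl (Eventually.of_forall h)

/-- Stronger than excluded middle, which gives only infinitely many negative values; inverses and
limits need all large `n`. -/
theorem IsPseudoConvergent.mem_or_eventually_neg (hs : IsPseudoConvergent v s) (φ : RatFunc K) :
    φ ∈ ringVE v s ∨ ∀ᶠ n in atTop, v (ratEval φ (s n)) < 0 := by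
  rw [mem_ringVE_iff]
  rcases eq_or_ne φ 0 with rfl | hφ
  · exact Or.inl (Eventually.of_forall fun n => by simp [ratEval])
  obtain ⟨g, hmono, hg⟩ := hs.exists_real_gauge
  obtain ⟨N, c, m, h⟩ := hs.exists_ratEval_eq hg hφ
  refine (hmono.eventually_affine_nonneg_or_neg c m).imp (fun h' => ?_) fun h' => ?_
  · filter_upwards [eventually_ge_atTop N, h'] with n hn hn'
    rw [(h n hn).1]
    exact_mod_cast hn'
  · filter_upwards [eventually_ge_atTop N, h'] with n hn hn'
    rw [(h n hn).1]
    exact_mod_cast hn'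

theorem algebraMap_valRing_ratFunc (d : valRing v) :
    algebraMap (valRing v) (RatFunc K) d = RatFunc.C (d : K) := by
  rw [IsScalarTower.algebraMap_apply (valRing v) K (RatFunc K), RatFunc.algebraMap_eq_C]
  rfl

/-- The valuation domain `V_E` of a pseudo-convergent sequence, as a subring of `K(X)`. -/
def IsPseudoConvergent.valuationSubring (hs : IsPseudoConvergent v s) :
    ValuationSubring (RatFunc K) where
  carrier := ringVE v s
  zero_mem' := mem_ringVE_iff.mpr (Eventually.of_forall fun n => by simp [ratEval])
  one_mem' := mem_ringVE_iff.mpr (Eventually.of_forall fun n => by simp [ratEval])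
  add_mem' {φ ψ} hφ hψ := by
    rw [mem_ringVE_iff] at *
    filter_upwards [hφ, hψ, hs.eventually_ratEval_add φ ψ] with n h h' h''
    rw [h'']
    exact v.map_le_add h h'
  mul_mem' {φ ψ} hφ hψ := by
    rw [mem_ringVE_iff] at *
    filter_upwards [hφ, hψ, hs.eventually_ratEval_mul φ ψ] with n h h' h''
    rw [h'', AddValuation.map_mul]
    exact add_nonneg h h'
  neg_mem' {φ} hφ := by
    rw [mem_ringVE_iff] at *
    filter_upwards [hφ, hs.eventually_ratEval_mul (RatFunc.C (-1)) φ] with n h h'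
    rw [ratEval_C, map_neg, map_one, neg_one_mul, neg_one_mul] at h'
    rwa [h', AddValuation.map_neg]
  mem_or_inv_mem' φ := by
    refine (hs.mem_or_eventually_neg φ).imp_right fun hneg => mem_ringVE_iff.mpr ?_
    rcases eq_or_ne φ 0 with rfl | hφ
    · exact Eventually.of_forall fun n => by simp [ratEval]
    filter_upwards [hneg, hs.eventually_ratEval_mul φ φ⁻¹] with n h h'
    have hsum : v (ratEval φ (s n)) + v (ratEval φ⁻¹ (s n)) = 0 := by
      rw [← AddValuation.map_mul, ← h', mul_inv_cancel₀ hφ]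
      simp [ratEval]
    by_contra hlt
    exact (add_neg_of_neg_of_nonpos h (not_le.mp hlt).le).ne hsum

/-- `V_E` as a point of `Zar(K(X)|V)`. -/
def IsPseudoConvergent.zarPoint (hs : IsPseudoConvergent v s) :
    ZarSpace (valRing v) (RatFunc K) :=
  ⟨hs.valuationSubring, fun d => mem_ringVE_iff.mpr (Eventually.of_forall fun n => by
    rw [algebraMap_valRing_ratFunc, ratEval_C]
    exact d.2)⟩

/-! ### The Ostrowski valuation of a sequence of finite breadth -/

/-- Finite breadth keeps the limit `c + m z` real; an unbounded gauge would send `c + m gₙ` to `±∞`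
when `m ≠ 0`. -/
theorem IsPseudoConvergent.exists_tendsto_ratEval (hs : IsPseudoConvergent v s) {z : ℝ}
    (hz : HasBreadth v s z) {φ : RatFunc K} (hφ : φ ≠ 0) :
    ∃ (a : ℕ → ℝ) (l : ℝ), (∀ᶠ n in atTop, v (ratEval φ (s n)) = a n) ∧
      Tendsto a atTop (𝓝 l) := by
  obtain ⟨g, -, hg⟩ := hs.exists_real_gauge
  obtain ⟨N, c, m, h⟩ := hs.exists_ratEval_eq hg hφ
  have hgz : Tendsto g atTop (𝓝 z) :=
    WithTop.isEmbedding_coe.tendsto_nhds_iff.mpr (hz.congr hg)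
  exact ⟨fun n => c + m * g n, c + m * z, eventually_atTop.mpr ⟨N, fun n hn => (h n hn).1⟩,
    tendsto_const_nhds.add (tendsto_const_nhds.mul hgz)⟩

theorem IsPseudoConvergent.exists_isOstrowskiValuation (hs : IsPseudoConvergent v s) {ζ : WithTop ℝ}
    (hζ : HasBreadth v s ζ) (hfin : ζ ≠ ⊤) : ∃ w, IsOstrowskiValuation v s w := by
  lift ζ to ℝ using hfin
  have hex : ∀ φ : RatFunc K, ∃ l, Tendsto (fun n => v (ratEval φ (s n))) atTop (𝓝 l) := by
    intro φ
    rcases eq_or_ne φ 0 with rfl | hφ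
    · exact ⟨⊤, tendsto_const_nhds.congr fun n => by simp [ratEval]⟩
    · obtain ⟨a, l, ha, hl⟩ := hs.exists_tendsto_ratEval hζ hφ
      exact ⟨l, Tendsto.congr' (ha.mono fun n hn => hn.symm)
        ((WithTop.continuous_coe.tendsto l).comp hl)⟩
  choose w hw using hex
  have hw0 : w 0 = ⊤ := tendsto_nhds_unique (hw 0)
    (tendsto_const_nhds.congr fun n => by simp [ratEval])
  have hw1 : w 1 = 0 := tendsto_nhds_unique (hw 1)
    (tendsto_const_nhds.congr fun n => by simp [ratEval])
  refine ⟨AddValuation.of w hw0 hw1 (fun φ ψ => ?_) (fun φ ψ => ?_), hw⟩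
  · refine le_of_tendsto_of_tendsto ((hw φ).min (hw ψ)) (hw (φ + ψ)) ?_
    filter_upwards [hs.eventually_ratEval_add φ ψ] with n hn
    rw [hn]
    exact v.map_add _ _
  · rcases eq_or_ne φ 0 with rfl | hφ
    · rw [zero_mul, hw0, top_add]
    rcases eq_or_ne ψ 0 with rfl | hψ
    · rw [mul_zero, hw0, add_top]
    -- Both limits are finite, so the sum is taken in `ℝ`.
    obtain ⟨a, l, ha, hl⟩ := hs.exists_tendsto_ratEval hζ hφ
    obtain ⟨b, l', hb, hl'⟩ := hs.exists_tendsto_ratEval hζ hψ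
    have hwφ : w φ = l := tendsto_nhds_unique (hw φ) (Tendsto.congr'
      (ha.mono fun n hn => hn.symm) ((WithTop.continuous_coe.tendsto l).comp hl))
    have hwψ : w ψ = l' := tendsto_nhds_unique (hw ψ) (Tendsto.congr'
      (hb.mono fun n hn => hn.symm) ((WithTop.continuous_coe.tendsto l').comp hl'))
    rw [hwφ, hwψ, ← WithTop.coe_add]
    refine tendsto_nhds_unique (hw (φ * ψ)) (Tendsto.congr' ?_
      ((WithTop.continuous_coe.tendsto (l + l')).comp (hl.add hl')))
    filter_upwards [ha, hb, hs.eventually_ratEval_mul φ ψ] with n h h' h''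
    rw [h'', AddValuation.map_mul, h, h']
    rfl

/-- `W_E` as a point of `Zar(K(X)|V)`. -/
def IsOstrowskiValuation.zarPoint {w : AddValuation (RatFunc K) (WithTop ℝ)}
    (hw : IsOstrowskiValuation v s w) : ZarSpace (valRing v) (RatFunc K) :=
  ⟨valRing w, fun d => by
    rw [mem_valRing, algebraMap_valRing_ratFunc]
    have h := hw (RatFunc.C (d : K))
    simp only [ratEval_C] at h
    rw [tendsto_nhds_unique h tendsto_const_nhds]
    exact d.2⟩

/-! ### Convergence -/

/-- A subbasic set tests finitely many functions, and an equivalence also handles complements. -/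
theorem ZarSpace.tendsto_of_eventually_mem_iff {D L ι : Type*} [CommRing D] [Field L] [Algebra D L]
    {l : Filter ι} {W : ι → ZarSpace D L} {W₀ : ZarSpace D L}
    (h : ∀ φ : L, ∀ᶠ i in l, (φ ∈ (W i).ring ↔ φ ∈ W₀.ring)) : Tendsto W l (𝓝 W₀) := by
  rw [TopologicalSpace.tendsto_nhds_generateFrom_iff]
  have hF : ∀ F : Finset L, ∀ᶠ i in l, (W i ∈ basicOpen D F ↔ W₀ ∈ basicOpen D F) := by
    intro F
    filter_upwards [(eventually_all_finset F).mpr fun φ _ => h φ] with i hi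
    exact forall₂_congr hi
  rintro _ ⟨F, rfl | rfl⟩ hW
  · filter_upwards [hF F] with i hi using hi.mpr hW
  · filter_upwards [hF F] with i hi using fun hmem => hW (hi.mp hmem)

theorem IsPseudoLimit.valuation_sub_eq_gaugeSeq {α : K} (h : IsPseudoLimit v s α) (n : ℕ) :
    v (s n - α) = gaugeSeq v s n := by
  have h1 : v (α - s n) < v (s (n + 1) - α) := by
    rw [AddValuation.map_sub_swap v (s (n + 1))]
    exact h n
  have h2 := v.map_add_eq_of_lt_right h1
  rw [sub_add_sub_cancel] at h2
  rw [gaugeSeq, h2, AddValuation.map_sub_swap]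

/-- A strictly increasing gauge never attains its limit; this strictness permits `ζₙ = δ`. -/
theorem HasBreadth.gauge_lt {δ : WithTop ℝ} (hδ : HasBreadth v s δ) (hs : IsPseudoConvergent v s)
    (n : ℕ) : v (s (n + 1) - s n) < δ := by
  have hmono : StrictMono (gaugeSeq v s) := strictMono_nat_of_lt_succ hs
  exact (hmono n.lt_succ_self).trans_le (hmono.monotone.ge_of_tendsto hδ _)

/-- If sequences `E n` pseudo-converge to the `s n`, with breadths at least that of `s`, then for
large `n` the values of `φ` along `E n` are eventually constant, equal to the value at `s n`. -/
theorem IsPseudoConvergent.eventually_ratEval_eq (hs : IsPseudoConvergent v s) {δ : WithTop ℝ}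
    (hδ : HasBreadth v s δ) {ζ : ℕ → WithTop ℝ} (hζ : ∀ n, δ ≤ ζ n) {E : ℕ → ℕ → K}
    (hlim : ∀ n, IsPseudoLimit v (E n) (s n)) (hbr : ∀ n, HasBreadth v (E n) (ζ n))
    (φ : RatFunc K) :
    ∀ᶠ n in atTop, ∀ᶠ k in atTop, v (ratEval φ (E n k)) = v (ratEval φ (s n)) := by
  rcases eq_or_ne φ 0 with rfl | hφ
  · simp [ratEval]
  obtain ⟨g, -, hg⟩ := hs.exists_real_gauge
  obtain ⟨N, c, m, h⟩ := hs.exists_ratEval_eq hg hφ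
  filter_upwards [eventually_ge_atTop N] with n hn
  have hlt : (g n : WithTop ℝ) < ζ n := by
    rw [← hg]
    exact (hδ.gauge_lt hs n).trans_le (hζ n)
  filter_upwards [(hbr n).eventually_const_lt hlt] with k hk
  exact (h n hn).2 _ (by rwa [(hlim n).valuation_sub_eq_gaugeSeq])

end Real

end

theorem proposition6p6 {K : Type*} [Field K] (v : AddValuation K (WithTop ℝ))
    (hv : IsRankOne v)
    (s : ℕ → K) (hs : IsPseudoConvergent v s) (halg : IsAlgebraicType v s)
    (δ : WithTop ℝ) (hδ : HasBreadth v s δ)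
    (ζ : ℕ → WithTop ℝ) (hζ : ∀ n, δ ≤ ζ n)
    (E : ℕ → ℕ → K) (hE : ∀ n, IsPseudoConvergent v (E n))
    (hlim : ∀ n, IsPseudoLimit v (E n) (s n))
    (hbr : ∀ n, HasBreadth v (E n) (ζ n)) :
    -- `V_E` and the `V_{Eₙ}` are points of `Zar(K(X)|V)`, and `V_{Eₙ} → V_E`
    ∃ VE : ZarSpace (valRing v) (RatFunc K),
      (VE.ring : Set (RatFunc K)) = ringVE v s ∧
      (∃ VEn : ℕ → ZarSpace (valRing v) (RatFunc K),
        (∀ n, ((VEn n).ring : Set (RatFunc K)) = ringVE v (E n)) ∧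
        Tendsto VEn atTop (𝓝 VE)) ∧
      -- if all `ζₙ` are finite, the `w_{Eₙ}` are valuations, and `W_{Eₙ} → V_E`
      ((∀ n, ζ n ≠ ⊤) →
        ∃ (w : ℕ → AddValuation (RatFunc K) (WithTop ℝ))
          (WEn : ℕ → ZarSpace (valRing v) (RatFunc K)),
          (∀ n, IsOstrowskiValuation v (E n) (w n)) ∧
          (∀ n, (WEn n).ring = valRing (w n)) ∧
          Tendsto WEn atTop (𝓝 VE)) := by
  refine ⟨hs.zarPoint, rfl, ⟨fun n => (hE n).zarPoint, fun n => rfl, ?_⟩, fun hfin => ?_⟩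
  · refine ZarSpace.tendsto_of_eventually_mem_iff fun φ => ?_
    change ∀ᶠ n in atTop, (φ ∈ ringVE v (E n) ↔ φ ∈ ringVE v s)
    have hconst := hs.eventually_ratEval_eq hδ hζ hlim hbr φ
    rcases hs.mem_or_eventually_neg φ with hφ | hφ
    · filter_upwards [hconst, mem_ringVE_iff.mp hφ] with n h h'
      refine iff_of_true (mem_ringVE_iff.mpr (h.mono fun k hk => ?_)) hφ
      rwa [hk]
    · have hnot : φ ∉ ringVE v s := fun hmem => by
        obtain ⟨n, h1, h2⟩ := ((mem_ringVE_iff.mp hmem).and hφ).exists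
        exact h1.not_gt h2
      filter_upwards [hconst, hφ] with n h h'
      refine iff_of_false (fun hmem => ?_) hnot
      -- Some late term of `E n` would give `φ` both a nonnegative value and the negative value at
      -- `s n`.
      obtain ⟨k, h1, h2⟩ := ((mem_ringVE_iff.mp hmem).and h).exists
      exact h1.not_gt (h2 ▸ h')
  · choose w hw using fun n => (hE n).exists_isOstrowskiValuation (hbr n) (hfin n)
    refine ⟨w, fun n => (hw n).zarPoint, hw, fun n => rfl, ?_⟩
    refine ZarSpace.tendsto_of_eventually_mem_iff fun φ => ?_
    change ∀ᶠ n in atTop, (0 ≤ w n φ ↔ φ ∈ ringVE v s)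
    have hwφ : ∀ᶠ n in atTop, w n φ = v (ratEval φ (s n)) := by
      filter_upwards [hs.eventually_ratEval_eq hδ hζ hlim hbr φ] with n h
      exact tendsto_nhds_unique (hw n φ)
        (tendsto_const_nhds.congr' (h.mono fun k hk => hk.symm))
    rcases hs.mem_or_eventually_neg φ with hφ | hφ
    · filter_upwards [hwφ, mem_ringVE_iff.mp hφ] with n h h'
      exact iff_of_true (h ▸ h') hφ
    · have hnot : φ ∉ ringVE v s := fun hmem => by
        obtain ⟨n, h1, h2⟩ := ((mem_ringVE_iff.mp hmem).and hφ).exists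
        exact h1.not_gt h2
      filter_upwards [hwφ, hφ] with n h h'
      exact iff_of_false (fun hle => (h ▸ hle).not_gt h') hnot
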